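/- Let $d\in\mathbb N_0$, $1\le p\le\infty$, and let $F_p$ be the space of absolutely continuous functions $g:[0,1]\to\mathbb C$ with $g'\in L_p[0,1]$. Let $F_{d,p}=\bigotimes_{j=1}^d F_p$ be the algebraic tensor product, i.e. the space of functions on $[0,1]^d$ spanned by the products $x\mapsto\prod_{j=1}^d g_j(x_j)$ with $g_j\in F_p$. For $u\subset[d]=\{1,\dots,d\}$ write $f^{(u)}=\prod_{j\in u}\frac{\partial}{\partial x_j}f$, and write $(x_u;t)$ for the point whose coordinates are $x_j$ for $j\in u$ and $t_j$ for $j\notin u$. Let $(\gamma_u)_{u\subset[d]}$ be nonnegative weights such that $\gamma_u>0$ implies $\gamma_v>0$ for all $v\subset u$. Consider the norms $$\|f\|_{\pitchfork,d,p}=\Big(\sum_{u\subset[d]}\gamma_u^{-p}\int_{[0,1]^u}|f^{(u)}(x_u;0)|^p\,dx_u\Big)^{1/p},$$ $$\|f\|_{A,d,p}=\Big(\sum_{u\subset[d]}\gamma_u^{-p}\int_{[0,1]^u}\Big|\int_{[0,1]^{[d]\setminus u}}f^{(u)}(x_u;t)\,dt\Big|^p\,dx_u\Big)^{1/p},$$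 for $p=\infty$ with the maximum over $u$ of $\gamma_u^{-1}$ times the $L_\infty$-norms; in both cases only those $f\in F_{d,p}$ are admitted for which the term of every $u$ with $\gamma_u=0$ vanishes, and these terms are omitted. Let $F_{\pitchfork,d,p}$ and $F_{A,d,p}$ be the completions of the resulting normed spaces. Put $$C_{d,1}=\max_{u\subset[d]}\sum_{v\subset u}\frac{\gamma_u}{\gamma_v},\qquad C_{d,\infty}=\max_{u\subset[d]}\sum_{v\subset [d]\setminus u}2^{-|v|}\frac{\gamma_{u\cup v}}{\gamma_u}\qquad(\text{with } 0/0=0).$$ Then every function admitted for one of the two norms is admitted for the other, the identity $f\mapsto f$ on these functions extends to bounded linear operators $$J^{\pitchfork,A}_{d,p}:F_{\pitchfork,d,p}\to F_{A,d,p},\qquad J^{A,\pitchfork}_{d,p}:F_{A,d,p}\to F_{\pitchfork,d,p},$$ and $$\|J^{\pitchfork,A}_{d,p}\|\le C_{d,1}^{1/p}\,C_{d,\infty}^{1-1/p},\qquad \|J^{A,\pitchfork}_{d,p}\|\le C_{d,1}^{1/p}\,C_{d,\infty}^{1-1/p}.$$ -/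

import Mathlib

open MeasureTheory Set
open scoped unitInterval ENNReal NNReal

noncomputable section

namespace AnchoredAnova

/-- The derivative of `g : [0,1] → ℂ` at `x` (one-sided at the end points). -/
def unitDeriv (g : I → ℂ) (x : I) : ℂ :=
  derivWithin (IccExtend (zero_le_one : (0 : ℝ) ≤ 1) g) (Icc 0 1) (x : ℝ)

/-- The univariate space `F_p`: absolutely continuous complex valued functions on `[0,1]` whose
derivative (which exists almost everywhere) belongs to `L_p`. -/
def univariate (p : ℝ≥0∞) : Set (I → ℂ) :=
  {g | AbsolutelyContinuousOnInterval (IccExtend (zero_le_one : (0 : ℝ) ≤ 1) g) 0 1 ∧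
    MemLp (unitDeriv g) p volume}

/-- The algebraic tensor product `F_{d,p} = F_p ⊗ ⋯ ⊗ F_p`, as a space of functions on `[0,1]^d`:
the linear span of the products `x ↦ ∏ j, g j (x j)` with factors in `F_p`. -/
def tensorSpace (d : ℕ) (p : ℝ≥0∞) : Submodule ℂ ((Fin d → I) → ℂ) :=
  Submodule.span ℂ {f | ∃ g : Fin d → I → ℂ, (∀ j, g j ∈ univariate p) ∧
    f = fun x => ∏ j, g j (x j)}

/-- The partial derivative with respect to the `j`-th variable. -/
def partialDeriv {d : ℕ} (j : Fin d) (f : (Fin d → I) → ℂ) (x : Fin d → I) : ℂ :=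
  unitDeriv (fun s => f (Function.update x j s)) (x j)

/-- The mixed derivative `f^{(u)}`: one derivative in each variable in `u`. -/
def mixedDeriv {d : ℕ} (u : Finset (Fin d)) (f : (Fin d → I) → ℂ) : (Fin d → I) → ℂ :=
  (u.sort (· ≤ ·)).foldr partialDeriv f

/-- The point `(x_u ; t_{uᶜ})` of `[0,1]^d`. -/
def glue {d : ℕ} (u : Finset (Fin d)) (x : u → I) (t : {j // j ∉ u} → I) : Fin d → I :=
  fun j => if h : j ∈ u then x ⟨j, h⟩ else t ⟨j, h⟩

/-- The function `x_u ↦ f^{(u)}(x_u ; 0)` on `[0,1]^u`. -/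
def anchoredPart {d : ℕ} (u : Finset (Fin d)) (f : (Fin d → I) → ℂ) (x : u → I) : ℂ :=
  mixedDeriv u f (glue u x 0)

/-- The function `x_u ↦ ∫ f^{(u)}(x_u ; t) dt` on `[0,1]^u`, where `t` runs over the remaining
variables. -/
def anovaPart {d : ℕ} (u : Finset (Fin d)) (f : (Fin d → I) → ℂ) (x : u → I) : ℂ :=
  ∫ t : {j // j ∉ u} → I, mixedDeriv u f (glue u x t)

/-! ### The parts are linear in `f ∈ F_{d,p}`, up to null sets, and belong to `L_p` -/

lemma univariate_continuous {p : ℝ≥0∞} {g : I → ℂ} (hg : g ∈ univariate p) : Continuous g := by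
  have h := hg.1.continuousOn
  rw [uIcc_of_le zero_le_one] at h
  have h2 : g = fun x : I => IccExtend (zero_le_one : (0 : ℝ) ≤ 1) g (x : ℝ) := by
    funext x; simp
  rw [h2]
  exact h.comp_continuous continuous_subtype_val (fun x => x.2)

/-- `g` is differentiable at the point `x` of `[0,1]`. -/
def DiffAt (g : I → ℂ) (x : I) : Prop :=
  DifferentiableWithinAt ℝ (IccExtend (zero_le_one : (0 : ℝ) ≤ 1) g) (Icc 0 1) (x : ℝ)

lemma univariate_diffAt {p : ℝ≥0∞} {g : I → ℂ} (hg : g ∈ univariate p) :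
    ∀ᵐ x : I, DiffAt g x := by
  have h := hg.1.boundedVariationOn
  rw [uIcc_of_le zero_le_one] at h
  have h2 := h.locallyBoundedVariationOn.ae_differentiableWithinAt_of_mem
  have h3 := unitInterval.measurePreserving_coe.quasiMeasurePreserving.ae
    (ae_restrict_of_ae (s := I) h2)
  filter_upwards [h3] with x hx
  exact hx x.2

/-- A finite sum of product functions. -/
def tensorSum {d : ℕ} {ι : Type} [Fintype ι] (c : ι → ℂ) (g : ι → Fin d → I → ℂ)
    (x : Fin d → I) : ℂ :=
  ∑ i, c i * ∏ j, g i j (x j)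

lemma exists_tensorSum {d : ℕ} {p : ℝ≥0∞} {f : (Fin d → I) → ℂ} (hf : f ∈ tensorSpace d p) :
    ∃ (n : ℕ) (c : Fin n → ℂ) (g : Fin n → Fin d → I → ℂ),
      (∀ i j, g i j ∈ univariate p) ∧ f = tensorSum c g := by
  obtain ⟨n, c, s, h⟩ := (Submodule.mem_span_set' ).1 hf
  choose g hg hs using fun i => (s i).2
  refine ⟨n, c, g, hg, ?_⟩
  rw [← h]
  funext x
  simp [tensorSum, hs]

lemma unitDeriv_tensorSum {d : ℕ} {ι : Type} [Fintype ι] (c : ι → ℂ)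
    (g : ι → Fin d → I → ℂ) (l : List (Fin d)) (hl : l.Nodup) (x : Fin d → I)
    (hx : ∀ j ∈ l, ∀ i, DiffAt (g i j) (x j)) :
    l.foldr partialDeriv (tensorSum c g) x =
      ∑ i, c i * ∏ j, (if j ∈ l then unitDeriv (g i j) else g i j) (x j) := by
  induction l generalizing x with
  | nil => simp [tensorSum]
  | cons k l ih =>
    obtain ⟨hk, hl⟩ := List.nodup_cons.1 hl
    have e : (fun s => l.foldr partialDeriv (tensorSum c g) (Function.update x k s)) =
        fun s => ∑ i, c i * (g i k s * ∏ j ∈ Finset.univ.erase k,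
          (if j ∈ l then unitDeriv (g i j) else g i j) (x j)) := by
      funext s
      rw [ih hl]
      · refine Finset.sum_congr rfl fun i _ => ?_
        rw [← Finset.mul_prod_erase _ _ (Finset.mem_univ k)]
        congr 2
        · simp [hk]
        · refine Finset.prod_congr rfl fun j hj => ?_
          rw [Function.update_of_ne (Finset.ne_of_mem_erase hj)]
      · intro j hj i
        have hne : j ≠ k := fun h => hk (h ▸ hj)
        rw [Function.update_of_ne hne]
        exact hx j (List.mem_cons_of_mem _ hj) i
    change unitDeriv (fun s => l.foldr partialDeriv (tensorSum c g) (Function.update x k s)) (x k)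
      = _
    rw [e]
    have hd : HasDerivWithinAt (IccExtend (zero_le_one : (0 : ℝ) ≤ 1) (fun s =>
        ∑ i, c i * (g i k s * ∏ j ∈ Finset.univ.erase k,
          (if j ∈ l then unitDeriv (g i j) else g i j) (x j))))
        (∑ i, c i * (unitDeriv (g i k) (x k) * ∏ j ∈ Finset.univ.erase k,
          (if j ∈ l then unitDeriv (g i j) else g i j) (x j))) (Icc 0 1) (x k : ℝ) := by
      have := HasDerivWithinAt.fun_sum (u := (Finset.univ : Finset ι)) fun i _ =>
        ((hx k List.mem_cons_self i).hasDerivWithinAt.mul_const (∏ j ∈ Finset.univ.erase k,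
          (if j ∈ l then unitDeriv (g i j) else g i j) (x j))).const_mul (c i)
      exact this
    refine (hd.derivWithin (uniqueDiffOn_Icc zero_lt_one _ (x k).2)).trans ?_
    refine Finset.sum_congr rfl fun i _ => ?_
    rw [← Finset.mul_prod_erase Finset.univ _ (Finset.mem_univ k)]
    congr 2
    · simp
    · refine Finset.prod_congr rfl fun j hj => ?_
      simp [Finset.ne_of_mem_erase hj]

lemma mixedDeriv_tensorSum {d : ℕ} {ι : Type} [Fintype ι] (c : ι → ℂ)
    (g : ι → Fin d → I → ℂ) (u : Finset (Fin d)) (x : u → I)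
    (hx : ∀ i, ∀ j : u, DiffAt (g i j) (x j)) (t : {j // j ∉ u} → I) :
    mixedDeriv u (tensorSum c g) (glue u x t) =
      ∑ i, c i * ((∏ j : {j // j ∉ u}, g i j (t j)) * ∏ j : u, unitDeriv (g i j) (x j)) := by
  unfold mixedDeriv
  rw [unitDeriv_tensorSum c g _ (Finset.sort_nodup _ _)]
  · refine Finset.sum_congr rfl fun i _ => ?_
    congr 1
    rw [← Fintype.prod_subtype_mul_prod_subtype (fun j => j ∈ u), mul_comm]
    congr 1
    · refine Finset.prod_congr rfl fun j _ => ?_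
      have := j.2
      simp [glue, this]
    · refine Finset.prod_congr (by ext; simp) fun j _ => ?_
      have := j.2
      simp [glue]
  · intro j hj i
    have hj : j ∈ u := by simpa using hj
    simpa [glue, hj] using hx i ⟨j, hj⟩

lemma ae_diffAt {d : ℕ} {p : ℝ≥0∞} {ι : Type} [Fintype ι] {g : ι → Fin d → I → ℂ}
    (hg : ∀ i j, g i j ∈ univariate p) (u : Finset (Fin d)) :
    ∀ᵐ x : u → I, ∀ i, ∀ j : u, DiffAt (g i j) (x j) := by
  rw [ae_all_iff]
  intro i
  rw [ae_all_iff]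
  intro j
  exact (Measure.quasiMeasurePreserving_eval (fun _ : u => (volume : Measure I)) j).ae
    (univariate_diffAt (hg i j))

lemma anchoredPart_tensorSum {d : ℕ} {p : ℝ≥0∞} {ι : Type} [Fintype ι] (c : ι → ℂ)
    {g : ι → Fin d → I → ℂ} (hg : ∀ i j, g i j ∈ univariate p) (u : Finset (Fin d)) :
    anchoredPart u (tensorSum c g) =ᵐ[volume] fun x => ∑ i, c i *
      ((∏ j : {j // j ∉ u}, g i j 0) * ∏ j : u, unitDeriv (g i j) (x j)) := by
  filter_upwards [ae_diffAt hg u] with x hx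
  exact mixedDeriv_tensorSum c g u x hx 0

lemma anovaPart_tensorSum {d : ℕ} {p : ℝ≥0∞} {ι : Type} [Fintype ι] (c : ι → ℂ)
    {g : ι → Fin d → I → ℂ} (hg : ∀ i j, g i j ∈ univariate p) (u : Finset (Fin d)) :
    anovaPart u (tensorSum c g) =ᵐ[volume] fun x => ∑ i, c i *
      ((∏ j : {j // j ∉ u}, ∫ s, g i j s) * ∏ j : u, unitDeriv (g i j) (x j)) := by
  filter_upwards [ae_diffAt hg u] with x hx
  unfold anovaPart
  simp_rw [mixedDeriv_tensorSum c g u x hx]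
  rw [integral_finsetSum]
  · refine Finset.sum_congr rfl fun i _ => ?_
    rw [integral_const_mul, integral_mul_const,
      integral_fintype_prod_volume_eq_prod (fun (j : {j // j ∉ u}) (s : I) => g i j s)]
  · intro i _
    refine Continuous.integrable_of_hasCompactSupport ?_ (HasCompactSupport.of_compactSpace _)
    refine continuous_const.mul (Continuous.mul ?_ continuous_const)
    exact continuous_finsetProd _ fun j _ =>
      (univariate_continuous (hg i j)).comp (continuous_apply j)

lemma memLp_prod {κ : Type*} [Fintype κ] {p : ℝ≥0∞} (g : κ → I → ℂ)
    (hg : ∀ j, MemLp (g j) p volume) :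
    MemLp (fun x : κ → I => ∏ j, g j (x j)) p volume := by
  have hm : AEStronglyMeasurable (fun x : κ → I => ∏ j, g j (x j)) volume :=
    Finset.aestronglyMeasurable_fun_prod _ fun j _ =>
      (hg j).1.comp_quasiMeasurePreserving
        (Measure.quasiMeasurePreserving_eval (fun _ : κ => (volume : Measure I)) j)
  rcases eq_or_ne p 0 with rfl | h0
  · exact memLp_zero_iff_aestronglyMeasurable.2 hm
  rcases eq_or_ne p ∞ with rfl | ht
  · have : ∀ j, ∃ C : ℝ, ∀ᵐ s : I, ‖g j s‖ ≤ C := fun j => by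
      have h := (hg j).2
      rw [eLpNorm_exponent_top] at h
      refine ⟨(eLpNormEssSup (g j) volume).toReal, ?_⟩
      filter_upwards [ae_le_eLpNormEssSup (f := g j) (μ := volume)] with s hs
      simpa using (ENNReal.toReal_le_toReal (by simp) h.ne).2 hs
    choose C hC using this
    refine memLp_top_of_bound hm (∏ j, C j) ?_
    have : ∀ᵐ x : κ → I, ∀ j, ‖g j (x j)‖ ≤ C j := by
      rw [ae_all_iff]
      exact fun j => (Measure.quasiMeasurePreserving_eval
        (fun _ : κ => (volume : Measure I)) j).ae (hC j)
    filter_upwards [this] with x hx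
    rw [norm_prod]
    exact Finset.prod_le_prod (fun _ _ => norm_nonneg _) fun j _ => hx j
  · rw [← integrable_norm_rpow_iff hm h0 ht]
    have : (fun x : κ → I => ‖∏ j, g j (x j)‖ ^ p.toReal) =
        fun x => ∏ j, ‖g j (x j)‖ ^ p.toReal := by
      funext x
      rw [norm_prod, Real.finsetProd_rpow _ _ (fun _ _ => norm_nonneg _)]
    rw [this]
    exact Integrable.fintype_prod (f := fun j s => ‖g j s‖ ^ p.toReal)
      fun j => (integrable_norm_rpow_iff (hg j).1 h0 ht).2 (hg j)

lemma memLp_sum_prod {d : ℕ} {p : ℝ≥0∞} {ι : Type} [Fintype ι] (c : ι → ℂ)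
    {g : ι → Fin d → I → ℂ} (hg : ∀ i j, g i j ∈ univariate p) (u : Finset (Fin d))
    (b : ι → ℂ) :
    MemLp (fun x : u → I => ∑ i, c i * (b i * ∏ j : u, unitDeriv (g i j) (x j))) p volume :=
  memLp_finsetSum _ fun i _ =>
    ((memLp_prod (fun j : u => unitDeriv (g i j)) fun j => (hg i j).2).const_mul (b i)).const_mul
      (c i)

lemma anchoredPart_memLp {d : ℕ} {p : ℝ≥0∞} {f : (Fin d → I) → ℂ} (hf : f ∈ tensorSpace d p)
    (u : Finset (Fin d)) : MemLp (anchoredPart u f) p volume := by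
  obtain ⟨n, c, g, hg, rfl⟩ := exists_tensorSum hf
  exact (memLp_congr_ae (anchoredPart_tensorSum c hg u)).2 (memLp_sum_prod c hg u _)

lemma anovaPart_memLp {d : ℕ} {p : ℝ≥0∞} {f : (Fin d → I) → ℂ} (hf : f ∈ tensorSpace d p)
    (u : Finset (Fin d)) : MemLp (anovaPart u f) p volume := by
  obtain ⟨n, c, g, hg, rfl⟩ := exists_tensorSum hf
  exact (memLp_congr_ae (anovaPart_tensorSum c hg u)).2 (memLp_sum_prod c hg u _)

lemma tensorSum_add_smul {d : ℕ} {ι κ : Type} [Fintype ι] [Fintype κ] (a : ℂ) (c : ι → ℂ)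
    (g : ι → Fin d → I → ℂ) (c' : κ → ℂ) (g' : κ → Fin d → I → ℂ) :
    tensorSum (Sum.elim c fun k => a * c' k) (Sum.elim g g') =
      tensorSum c g + a • tensorSum c' g' := by
  funext x
  simp [tensorSum, Finset.mul_sum, mul_assoc]

lemma anchoredPart_add_smul {d : ℕ} {p : ℝ≥0∞} {f h : (Fin d → I) → ℂ}
    (hf : f ∈ tensorSpace d p) (hh : h ∈ tensorSpace d p) (a : ℂ) (u : Finset (Fin d)) :
    anchoredPart u (f + a • h) =ᵐ[volume] anchoredPart u f + a • anchoredPart u h := by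
  obtain ⟨n, c, g, hg, rfl⟩ := exists_tensorSum hf
  obtain ⟨m, c', g', hg', rfl⟩ := exists_tensorSum hh
  rw [← tensorSum_add_smul]
  filter_upwards [anchoredPart_tensorSum c hg u, anchoredPart_tensorSum c' hg' u,
    anchoredPart_tensorSum (p := p) (Sum.elim c fun k => a * c' k) (g := Sum.elim g g')
      (by rintro (i | i) <;> simp [hg, hg']) u] with x h1 h2 h3
  rw [h3, Pi.add_apply, Pi.smul_apply, h1, h2]
  simp [Finset.mul_sum, mul_assoc]

lemma anovaPart_add_smul {d : ℕ} {p : ℝ≥0∞} {f h : (Fin d → I) → ℂ}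
    (hf : f ∈ tensorSpace d p) (hh : h ∈ tensorSpace d p) (a : ℂ) (u : Finset (Fin d)) :
    anovaPart u (f + a • h) =ᵐ[volume] anovaPart u f + a • anovaPart u h := by
  obtain ⟨n, c, g, hg, rfl⟩ := exists_tensorSum hf
  obtain ⟨m, c', g', hg', rfl⟩ := exists_tensorSum hh
  rw [← tensorSum_add_smul]
  filter_upwards [anovaPart_tensorSum c hg u, anovaPart_tensorSum c' hg' u,
    anovaPart_tensorSum (p := p) (Sum.elim c fun k => a * c' k) (g := Sum.elim g g')
      (by rintro (i | i) <;> simp [hg, hg']) u] with x h1 h2 h3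
  rw [h3, Pi.add_apply, Pi.smul_apply, h1, h2]
  simp [Finset.mul_sum, mul_assoc]

/-! ### The spaces -/

/-- A linear map out of a submodule, from `L_p` representatives which are linear up to null
sets. -/
def linearOfRep {d : ℕ} {p : ℝ≥0∞} {u : Finset (Fin d)}
    (T : ((Fin d → I) → ℂ) → (u → I) → ℂ)
    (hT : ∀ f ∈ tensorSpace d p, MemLp (T f) p volume)
    (hlin : ∀ f ∈ tensorSpace d p, ∀ h ∈ tensorSpace d p, ∀ a : ℂ,
      T (f + a • h) =ᵐ[volume] T f + a • T h) :
    tensorSpace d p →ₗ[ℂ] Lp ℂ p (volume : Measure (u → I)) :=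
  IsLinearMap.mk' (fun f => (hT f.1 f.2).toLp (T f.1)) <| by
    have key : ∀ (f h : tensorSpace d p) (a : ℂ),
        (hT (f + a • h).1 (f + a • h).2).toLp (T (f + a • h).1) =
          (hT f.1 f.2).toLp (T f.1) + a • (hT h.1 h.2).toLp (T h.1) := fun f h a => by
      rw [← MemLp.toLp_const_smul, ← MemLp.toLp_add, MemLp.toLp_eq_toLp_iff]
      exact hlin f.1 f.2 h.1 h.2 a
    have h0 : (hT (0 : tensorSpace d p).1 (0 : tensorSpace d p).2).toLp
        (T (0 : tensorSpace d p).1) = 0 := by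
      simpa using key 0 0 1
    constructor
    · intro f h
      simpa using key f h 1
    · intro a h
      have := key 0 h a
      rw [h0] at this
      simpa using this

/-- `f ↦ (f^{(u)}(· ; 0))_u`, as classes in `L_p([0,1]^u)`. -/
def anchoredTuple (d : ℕ) (p : ℝ≥0∞) :
    tensorSpace d p →ₗ[ℂ] ∀ u : Finset (Fin d), Lp ℂ p (volume : Measure (u → I)) :=
  LinearMap.pi fun u => linearOfRep (anchoredPart u) (fun _ hf => anchoredPart_memLp hf u)
    fun _ hf _ hh a => anchoredPart_add_smul hf hh a u

/-- `f ↦ (∫ f^{(u)}(· ; t) dt)_u`, as classes in `L_p([0,1]^u)`. -/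
def anovaTuple (d : ℕ) (p : ℝ≥0∞) :
    tensorSpace d p →ₗ[ℂ] ∀ u : Finset (Fin d), Lp ℂ p (volume : Measure (u → I)) :=
  LinearMap.pi fun u => linearOfRep (anovaPart u) (fun _ hf => anovaPart_memLp hf u)
    fun _ hf _ hh a => anovaPart_add_smul hf hh a u

section Weighted

variable {d : ℕ} {p : ℝ≥0∞}
  (R : tensorSpace d p →ₗ[ℂ] ∀ u : Finset (Fin d), Lp ℂ p (volume : Measure (u → I)))
  (γ : Finset (Fin d) → ℝ≥0)

/-- The functions `f ∈ F_{d,p}` whose `u`-th component `R f u` vanishes whenever `γ u = 0`. -/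
def preSubmodule : Submodule ℂ (tensorSpace d p) where
  carrier := {f | ∀ u, γ u = 0 → R f u = 0}
  add_mem' := fun hf hh u hu => by simp [hf u hu, hh u hu]
  zero_mem' := fun u _ => by simp
  smul_mem' := fun a f hf u hu => by simp [hf u hu]

/-- The type of elements of `preSubmodule`, with the norm `(∑ u, γ_u^{-p} ‖R f u‖_p^p)^{1/p}`
(for `p = ∞`: `max_u γ_u^{-1} ‖R f u‖_∞`), see below. -/
def PreSpace : Type := preSubmodule R γ

instance : AddCommGroup (PreSpace R γ) := inferInstanceAs (AddCommGroup (preSubmodule R γ))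

instance : Module ℂ (PreSpace R γ) := inferInstanceAs (Module ℂ (preSubmodule R γ))

/-- The function on `[0,1]^d` underlying an element of `PreSpace`. -/
def PreSpace.toFun {R : tensorSpace d p →ₗ[ℂ] ∀ u : Finset (Fin d),
    Lp ℂ p (volume : Measure (u → I))} {γ : Finset (Fin d) → ℝ≥0} (f : PreSpace R γ) :
    (Fin d → I) → ℂ :=
  f.1.1

lemma PreSpace.toFun_mem {R : tensorSpace d p →ₗ[ℂ] ∀ u : Finset (Fin d),
    Lp ℂ p (volume : Measure (u → I))} {γ : Finset (Fin d) → ℝ≥0} (f : PreSpace R γ) :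
    f.toFun ∈ tensorSpace d p :=
  f.1.2

/-- The weighted tuple `(γ_u^{-1} R f u)_u` in the `ℓ_p`-sum of the spaces `L_p([0,1]^u)`. The
components with `γ u = 0` are zero. -/
def weightedTuple :
    PreSpace R γ →ₗ[ℂ] PiLp p fun u : Finset (Fin d) => Lp ℂ p (volume : Measure (u → I)) :=
  (WithLp.linearEquiv p ℂ (∀ u : Finset (Fin d), Lp ℂ p (volume : Measure (u → I)))).symm.toLinearMap
    ∘ₗ LinearMap.pi (fun u => ((γ u : ℝ)⁻¹ : ℂ) • LinearMap.proj u ∘ₗ R)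
    ∘ₗ (preSubmodule R γ).subtype

instance [Fact (1 ≤ p)] : SeminormedAddCommGroup (PreSpace R γ) :=
  SeminormedAddCommGroup.induced _ _ (weightedTuple R γ)

instance [Fact (1 ≤ p)] : NormedSpace ℂ (PreSpace R γ) :=
  NormedSpace.induced ℂ _ _ (weightedTuple R γ)

end Weighted

/-- `G_{⋔,d,p}`: functions in `F_{d,p}` with the anchored norm. -/
abbrev AnchoredPre (d : ℕ) (p : ℝ≥0∞) (γ : Finset (Fin d) → ℝ≥0) : Type :=
  PreSpace (anchoredTuple d p) γ

/-- `G_{A,d,p}`: functions in `F_{d,p}` with the ANOVA norm. -/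
abbrev AnovaPre (d : ℕ) (p : ℝ≥0∞) (γ : Finset (Fin d) → ℝ≥0) : Type :=
  PreSpace (anovaTuple d p) γ

/-- The weighted anchored space `F_{⋔,d,p}`, the completion of `G_{⋔,d,p}`. -/
abbrev AnchoredSpace (d : ℕ) (p : ℝ≥0∞) [Fact (1 ≤ p)] (γ : Finset (Fin d) → ℝ≥0) : Type :=
  UniformSpace.Completion (AnchoredPre d p γ)

/-- The weighted ANOVA space `F_{A,d,p}`, the completion of `G_{A,d,p}`. -/
abbrev AnovaSpace (d : ℕ) (p : ℝ≥0∞) [Fact (1 ≤ p)] (γ : Finset (Fin d) → ℝ≥0) : Type :=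
  UniformSpace.Completion (AnovaPre d p γ)

/-- `C_{d,1} = max_u ∑_{v ⊆ u} γ_u / γ_v`, with `0 / 0 = 0`. -/
def constOne {d : ℕ} (γ : Finset (Fin d) → ℝ≥0) : ℝ :=
  Finset.univ.sup' Finset.univ_nonempty fun u : Finset (Fin d) =>
    ∑ v ∈ u.powerset, (γ u : ℝ) / γ v

/-- `C_{d,∞} = max_u ∑_{v ⊆ uᶜ} 2^{-|v|} γ_{u ∪ v} / γ_u`, with `0 / 0 = 0`. -/
def constInfty {d : ℕ} (γ : Finset (Fin d) → ℝ≥0) : ℝ :=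
  Finset.univ.sup' Finset.univ_nonempty fun u : Finset (Fin d) =>
    ∑ v ∈ uᶜ.powerset, (2 : ℝ)⁻¹ ^ v.card * ((γ (u ∪ v) : ℝ) / γ u)

end AnchoredAnova

end

/-! The anchored and the ANOVA decomposition determine each other by one univariate identity: an
absolutely continuous `g` satisfies `∫ g = g 0 + ∫ (1 - s) g' s ds` (`integral_univariate`). Both
the anchored component `f^{(u)}(· ; 0)` and the ANOVA component `∫ f^{(u)}(· ; t) dt` of a sum of
products `∏ j, g j (x j)` are obtained by keeping the derivative in the variables in `u` and
putting a number, `g j 0` respectively `∫ g j`, in the other variables. Expanding the product over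
`j ∉ u` therefore gives, with `ε = 1` in one direction and `ε = -1` in the other,
`b_u(x_u) = ∑_{v ⊆ uᶜ} ε^{|v|} ∫ ∏_{j ∈ v} (1 - t_j) a_{u ∪ v}(x_u, t_v) dt_v`
(`mixedSum_expand`). Only the resulting bound for `|b_u|` matters, so both embeddings are treated
at once, through the relation `Dominates`.

After division by the weights, the bound says that `(|b_u| / γ_u)_u` is at most the image of
`(|a_w| / γ_w)_w` under a nonnegative integral operator with kernels
`(γ_{u ∪ v} / γ_u) ∏_{j ∈ v} (1 - t_j)`. Its row sums are at most `C_{d,∞}`, since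
`∫ (1 - s) ds = 1/2`, and its column sums at most `C_{d,1}`, since `1 - s ≤ 1`. Hölder's inequality
with respect to the kernel (the Schur test, `sum_lintegral_rpow_le`) bounds its norm on `ℓ_p(L_p)`
by `C_{d,1}^{1/p} C_{d,∞}^{1-1/p}`; for `p = ∞` the row sums suffice (`ae_le_of_ae_le_const`).
Components with `γ_u = 0` cause no trouble: `γ_u = 0` forces `γ_w = 0`, hence `a_w = 0`, for all
`w ⊇ u`. The bounded linear map so obtained is then extended to the completions.

The functions of `x_u` are pulled back to the whole cube `[0,1]^d`, where the point `(x_u ; t)` is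
`u.piecewise x t`; the map `(x, t) ↦ u.piecewise x t` preserves the measure. -/

namespace AnchoredAnova

/-! ### The univariate identity -/

lemma absolutelyContinuous_lipschitz_comp {X Y : Type*} [PseudoMetricSpace X] [PseudoMetricSpace Y]
    {f : ℝ → X} {a b : ℝ} (hf : AbsolutelyContinuousOnInterval f a b) {φ : X → Y}
    (hφ : LipschitzWith 1 φ) : AbsolutelyContinuousOnInterval (fun x => φ (f x)) a b := by
  rw [absolutelyContinuousOnInterval_iff] at hf ⊢
  intro ε hε
  obtain ⟨δ, hδ, h⟩ := hf ε hε
  refine ⟨δ, hδ, fun E hE hlt => lt_of_le_of_lt (Finset.sum_le_sum fun i _ => ?_) (h E hE hlt)⟩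
  simpa using hφ.dist_le_mul (f (E.2 i).1) (f (E.2 i).2)

lemma integral_eq_intervalIntegral {E : Type*} [NormedAddCommGroup E] [NormedSpace ℝ E]
    (h : ℝ → E) : ∫ s : I, h s = ∫ x in (0 : ℝ)..1, h x := by
  rw [intervalIntegral.integral_of_le zero_le_one, ← integral_Icc_eq_integral_Ioc]
  exact integral_subtype_comap measurableSet_Icc h

lemma integral_one_sub_mul_deriv {F : ℝ → ℝ} (hF : AbsolutelyContinuousOnInterval F 0 1) :
    ∫ x in (0 : ℝ)..1, (1 - x) * deriv F x = (∫ x in (0 : ℝ)..1, F x) - F 0 := by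
  have h1 : AbsolutelyContinuousOnInterval (fun x : ℝ => 1 - x) 0 1 :=
    ContDiffOn.absolutelyContinuousOnInterval (by fun_prop)
  have h2 : deriv (fun x : ℝ => 1 - x) = fun _ => -1 := by
    funext x; simp
  rw [h1.integral_mul_deriv_eq_deriv_mul hF, h2]
  simp
  ring

/-- Almost every point of `[0,1]` is interior. -/
lemma ae_mem_Ioo : ∀ᵐ x : I, (x : ℝ) ∈ Ioo (0 : ℝ) 1 := by
  have h : ∀ᵐ y : ℝ, y ∈ (I : Set ℝ) → y ∈ Ioo (0 : ℝ) 1 := by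
    filter_upwards [Measure.ae_ne volume (0 : ℝ), Measure.ae_ne volume (1 : ℝ)] with y h0 h1 hy
    exact ⟨lt_of_le_of_ne hy.1 h0.symm, lt_of_le_of_ne hy.2 h1⟩
  have := unitInterval.measurePreserving_coe.quasiMeasurePreserving.ae
    (ae_restrict_of_ae (s := I) h)
  filter_upwards [this] with x hx using hx x.2

/-- Integration by parts for the real function `φ ∘ g`, where `φ` is the real or the imaginary
part: Mathlib has it for real valued functions only. -/
lemma integral_one_sub_mul_unitDeriv_comp {p : ℝ≥0∞} {g : I → ℂ}
    (hg : g ∈ univariate p) (φ : ℂ →L[ℝ] ℝ) (hφ : LipschitzWith 1 φ) :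
    ∫ s : I, (1 - (s : ℝ)) * φ (unitDeriv g s) = (∫ s : I, φ (g s)) - φ (g 0) := by
  set G := IccExtend (zero_le_one : (0 : ℝ) ≤ 1) g with hG
  have hAC := absolutelyContinuous_lipschitz_comp hg.1 hφ
  have h := integral_one_sub_mul_deriv hAC
  rw [← integral_eq_intervalIntegral, ← integral_eq_intervalIntegral] at h
  have e0 : G 0 = g 0 := by
    simp [hG]
  rw [← hG, e0] at h
  simp only [hG, IccExtend_val] at h
  rw [← h]
  refine integral_congr_ae ?_
  filter_upwards [univariate_diffAt hg, ae_mem_Ioo] with x hx hx'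
  congr 1
  have hd : HasDerivAt G (unitDeriv g x) (x : ℝ) :=
    hx.hasDerivWithinAt.hasDerivAt (Icc_mem_nhds hx'.1 hx'.2)
  exact ((φ.hasFDerivAt.comp_hasDerivAt (x : ℝ) hd).deriv).symm

lemma unitDeriv_integrable {p : ℝ≥0∞} (hp : 1 ≤ p) {g : I → ℂ} (hg : g ∈ univariate p) :
    Integrable (unitDeriv g) volume :=
  hg.2.integrable hp

lemma integrable_one_sub_mul {D : I → ℂ} (hD : Integrable D volume) :
    Integrable (fun s : I => ((1 - (s : ℝ) : ℝ) : ℂ) * D s) volume := by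
  refine hD.bdd_mul (c := 1) (by fun_prop) ?_
  filter_upwards with s
  rw [Complex.norm_real, Real.norm_eq_abs, abs_le]
  constructor <;> linarith [s.2.1, s.2.2]

/-- The mean of an absolutely continuous function differs from its value at `0` by the mean of
its derivative with respect to the kernel `1 - s`. -/
lemma integral_univariate {p : ℝ≥0∞} (hp : 1 ≤ p) {g : I → ℂ} (hg : g ∈ univariate p) :
    ∫ s : I, g s = g 0 + ∫ s : I, ((1 - (s : ℝ) : ℝ) : ℂ) * unitDeriv g s := by
  have hi := integrable_one_sub_mul (unitDeriv_integrable hp hg)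
  have hgi : Integrable g volume := (univariate_continuous hg).integrable_of_hasCompactSupport
    (HasCompactSupport.of_compactSpace _)
  have hre := integral_one_sub_mul_unitDeriv_comp hg Complex.reCLM
    (LipschitzWith.of_dist_le_mul fun a b => by
      simpa [dist_eq_norm] using Complex.abs_re_le_norm (a - b))
  have him := integral_one_sub_mul_unitDeriv_comp hg Complex.imCLM
    (LipschitzWith.of_dist_le_mul fun a b => by
      simpa [dist_eq_norm] using Complex.abs_im_le_norm (a - b))
  have r1 := Complex.reCLM.integral_comp_comm hi
  have r2 := Complex.imCLM.integral_comp_comm hi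
  have r3 := Complex.reCLM.integral_comp_comm hgi
  have r4 := Complex.imCLM.integral_comp_comm hgi
  simp only [Complex.reCLM_apply, Complex.imCLM_apply, Complex.re_ofReal_mul,
    Complex.im_ofReal_mul] at *
  apply Complex.ext
  · rw [Complex.add_re, ← r1, ← r3, hre]; ring
  · rw [Complex.add_im, ← r2, ← r4, him]; ring

/-! ### Measure preserving maps of the cube -/

lemma measurePreserving_piecewise {d : ℕ} (u : Finset (Fin d)) :
    MeasurePreserving (fun z : (Fin d → I) × (Fin d → I) => u.piecewise z.1 z.2)
      (volume.prod volume) volume := by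
  have hm : Measurable (fun z : (Fin d → I) × (Fin d → I) => u.piecewise z.1 z.2) := by
    refine measurable_pi_lambda _ fun j => ?_
    by_cases hj : j ∈ u <;> simp only [Finset.piecewise, hj, if_true, if_false] <;> fun_prop
  refine ⟨hm, (Measure.pi_eq fun s hs => ?_).symm⟩
  rw [Measure.map_apply hm (MeasurableSet.univ_pi hs)]
  -- The preimage of a box under gluing is a product of two boxes.
  have : (fun z : (Fin d → I) × (Fin d → I) => u.piecewise z.1 z.2) ⁻¹' univ.pi s =
      (univ.pi fun j => if j ∈ u then s j else univ) ×ˢ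
        (univ.pi fun j => if j ∈ u then univ else s j) := by
    ext z
    simp only [mem_preimage, mem_pi, mem_univ, true_imp_iff, mem_prod, ← forall_and]
    refine forall_congr' fun j => ?_
    by_cases hj : j ∈ u <;> simp [hj]
  rw [this, Measure.prod_prod, volume_pi, Measure.pi_pi, Measure.pi_pi, ← Finset.prod_mul_distrib]
  refine Finset.prod_congr rfl fun j _ => ?_
  by_cases hj : j ∈ u <;> simp [hj]

lemma measurePreserving_restrict {d : ℕ} (u : Finset (Fin d)) :
    MeasurePreserving (fun (z : Fin d → I) (j : u) => z j) volume volume := by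
  have hm : Measurable (fun (z : Fin d → I) (j : u) => z j) := by fun_prop
  refine ⟨hm, (Measure.pi_eq fun s hs => ?_).symm⟩
  rw [Measure.map_apply hm (MeasurableSet.univ_pi hs)]
  have : (fun (z : Fin d → I) (j : u) => z j) ⁻¹' univ.pi s =
      univ.pi fun j => if h : j ∈ u then s ⟨j, h⟩ else univ := by
    ext z
    simp only [mem_preimage, mem_pi, mem_univ, true_imp_iff]
    constructor
    · intro h j
      by_cases hj : j ∈ u <;> simp [hj]
      exact h ⟨j, hj⟩
    · intro h j
      simpa using h j
  rw [this, volume_pi, Measure.pi_pi]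
  rw [← Fintype.prod_subtype_mul_prod_subtype (fun j => j ∈ u)]
  rw [Finset.prod_eq_one (s := (Finset.univ : Finset {j // j ∉ u})), mul_one]
  · refine Finset.prod_congr (by ext; simp) fun j _ => ?_
    simp
  · rintro ⟨j, hj⟩ -
    simp [hj]

/-! ### Expansion of the components over subsets -/

/-- The tensor kernel `t ↦ ∏_{j ∈ v} (1 - t_j)`. -/
def kernel {d : ℕ} (v : Finset (Fin d)) (t : Fin d → I) : ℝ := ∏ j ∈ v, (1 - (t j : ℝ))

lemma kernel_nonneg {d : ℕ} (v : Finset (Fin d)) (t : Fin d → I) : 0 ≤ kernel v t :=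
  Finset.prod_nonneg fun j _ => sub_nonneg.2 (t j).2.2

lemma kernel_le_one {d : ℕ} (v : Finset (Fin d)) (t : Fin d → I) : kernel v t ≤ 1 :=
  Finset.prod_le_one (fun j _ => sub_nonneg.2 (t j).2.2) fun j _ => by linarith [(t j).2.1]

lemma continuous_kernel {d : ℕ} (v : Finset (Fin d)) : Continuous (kernel v) := by
  unfold kernel; fun_prop

lemma integral_one_sub : ∫ s : I, (1 - (s : ℝ)) = 2⁻¹ := by
  rw [integral_eq_intervalIntegral (fun s => 1 - s), intervalIntegral.integral_sub (by simp)
    (by simp)]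
  norm_num [integral_id]

lemma integral_kernel {d : ℕ} (v : Finset (Fin d)) : ∫ t, kernel v t = 2⁻¹ ^ v.card := by
  have h : kernel v = fun t => ∏ j, (fun j (s : I) => if j ∈ v then 1 - (s : ℝ) else 1) j (t j) := by
    funext t
    simp [kernel, Finset.prod_ite_mem]
  rw [h, integral_fintype_prod_volume_eq_prod
    (fun (j : Fin d) (s : I) => if j ∈ v then 1 - (s : ℝ) else 1)]
  have h2 : ∀ j, (∫ s : I, if j ∈ v then 1 - (s : ℝ) else 1) = if j ∈ v then 2⁻¹ else 1 := by
    intro j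
    split_ifs
    · exact integral_one_sub
    · simp
  simp [h2, Finset.prod_ite_mem]

lemma lintegral_kernel {d : ℕ} (v : Finset (Fin d)) :
    ∫⁻ t, ENNReal.ofReal (kernel v t) = 2⁻¹ ^ v.card := by
  rw [← ofReal_integral_eq_lintegral_ofReal, integral_kernel, ENNReal.ofReal_pow (by norm_num)]
  · congr 1
    rw [ENNReal.ofReal_inv_of_pos (by norm_num)]; norm_num
  · exact (continuous_kernel v).integrable_of_hasCompactSupport
      (HasCompactSupport.of_compactSpace _)
  · exact Filter.Eventually.of_forall fun t => kernel_nonneg v t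

/-- The function `x ↦ ∑ i, c i * ∏_{j ∈ u} D i j (x j) * ∏_{j ∉ u} α i j`. For `D i j = (g i j)'`
it is the pullback to the cube of the anchored (`α i j = g i j 0`) or ANOVA (`α i j = ∫ g i j`)
component of `∑ i, c i * ∏ j, g i j`. -/
def mixedSum {d : ℕ} {ι : Type} [Fintype ι] (c : ι → ℂ) (D : ι → Fin d → I → ℂ)
    (α : ι → Fin d → ℂ) (u : Finset (Fin d)) (x : Fin d → I) : ℂ :=
  ∑ i, c i * ∏ j, if j ∈ u then D i j (x j) else α i j

section

variable {d : ℕ}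

/-- After multiplication with the kernel, the integrand splits into factors that each depend on a
single variable `t j`. -/
lemma kernel_mul_prod (D : Fin d → I → ℂ) (α : Fin d → ℂ) {u v : Finset (Fin d)}
    (huv : Disjoint u v) (x t : Fin d → I) :
    (kernel v t : ℂ) * ∏ j, (if j ∈ u ∪ v then D j (u.piecewise x t j) else α j) =
      ∏ j, (fun j (s : I) => if j ∈ u then D j (x j) else
        if j ∈ v then ((1 - (s : ℝ) : ℝ) : ℂ) * D j s else α j) j (t j) := by
  have h : (kernel v t : ℂ) = ∏ j, if j ∈ v then ((1 - (t j : ℝ) : ℝ) : ℂ) else 1 := by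
    simp [kernel, Finset.prod_ite_mem]
  rw [h, ← Finset.prod_mul_distrib]
  refine Finset.prod_congr rfl fun j _ => ?_
  by_cases hu : j ∈ u
  · have hv : j ∉ v := Finset.disjoint_left.1 huv hu
    simp [hu, hv]
  · by_cases hv : j ∈ v <;> simp [hu, hv]

lemma integrable_kernel_mul_prod {D : Fin d → I → ℂ} (hD : ∀ j, Integrable (D j) volume)
    (α : Fin d → ℂ) {u v : Finset (Fin d)} (huv : Disjoint u v) (x : Fin d → I) :
    Integrable (fun t => (kernel v t : ℂ) *
      ∏ j, (if j ∈ u ∪ v then D j (u.piecewise x t j) else α j)) volume := by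
  simp_rw [kernel_mul_prod D α huv]
  refine Integrable.fintype_prod (f := fun j (s : I) => if j ∈ u then D j (x j) else
        if j ∈ v then ((1 - (s : ℝ) : ℝ) : ℂ) * D j s else α j) fun j => ?_
  by_cases hu : j ∈ u
  · simp [hu]
  · by_cases hv : j ∈ v
    · simpa [hu, hv] using integrable_one_sub_mul (hD j)
    · simp [hu, hv]

lemma integral_kernel_mul_prod (D : Fin d → I → ℂ) (α : Fin d → ℂ) {u v : Finset (Fin d)}
    (huv : Disjoint u v) (x : Fin d → I) :
    ∫ t, (kernel v t : ℂ) * ∏ j, (if j ∈ u ∪ v then D j (u.piecewise x t j) else α j) =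
      ∏ j, if j ∈ u then D j (x j) else
        if j ∈ v then ∫ s : I, ((1 - (s : ℝ) : ℝ) : ℂ) * D j s else α j := by
  simp_rw [kernel_mul_prod D α huv]
  rw [integral_fintype_prod_volume_eq_prod (fun j (s : I) => if j ∈ u then D j (x j) else
        if j ∈ v then ((1 - (s : ℝ) : ℝ) : ℂ) * D j s else α j)]
  refine Finset.prod_congr rfl fun j _ => ?_
  split_ifs <;> simp

lemma prod_expand (D : Fin d → I → ℂ) (α β : Fin d → ℂ) (ε : ℂ)
    (h : ∀ j, β j = α j + ε * ∫ s : I, ((1 - (s : ℝ) : ℝ) : ℂ) * D j s)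
    (u : Finset (Fin d)) (x : Fin d → I) :
    (∏ j, if j ∈ u then D j (x j) else β j) = ∑ v ∈ uᶜ.powerset, ε ^ v.card *
      ∫ t, (kernel v t : ℂ) * ∏ j, (if j ∈ u ∪ v then D j (u.piecewise x t j) else α j) := by
  set m : Fin d → ℂ := fun j => ∫ s : I, ((1 - (s : ℝ) : ℝ) : ℂ) * D j s with hm
  have e1 : (∏ j, if j ∈ u then D j (x j) else β j) =
      (∏ j ∈ u, D j (x j)) * ∏ j ∈ uᶜ, (ε * m j + α j) := by
    rw [← Finset.prod_mul_prod_compl u]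
    congr 1
    · exact Finset.prod_congr rfl fun j hj => by simp [hj]
    · exact Finset.prod_congr rfl fun j hj => by
        rw [if_neg (Finset.mem_compl.1 hj), h, add_comm]
  rw [e1, Finset.prod_add, Finset.mul_sum]
  refine Finset.sum_congr rfl fun v hv => ?_
  have hv' := Finset.mem_powerset.1 hv
  have huv : Disjoint u v := Finset.disjoint_left.2 fun j hj hj' =>
    Finset.mem_compl.1 (hv' hj') hj
  rw [integral_kernel_mul_prod D α huv, ← Finset.prod_mul_prod_compl u,
    ← Finset.prod_sdiff hv', Finset.prod_mul_distrib, Finset.prod_const]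
  have a1 : (∏ j ∈ u, if j ∈ u then D j (x j) else if j ∈ v then m j else α j) =
      ∏ j ∈ u, D j (x j) := Finset.prod_congr rfl fun j hj => by simp [hj]
  have a2 : (∏ j ∈ v, if j ∈ u then D j (x j) else if j ∈ v then m j else α j) =
      ∏ j ∈ v, m j := Finset.prod_congr rfl fun j hj => by
        simp [hj, Finset.disjoint_right.1 huv hj]
  have a3 : (∏ j ∈ uᶜ \ v, if j ∈ u then D j (x j) else if j ∈ v then m j else α j) =
      ∏ j ∈ uᶜ \ v, α j := Finset.prod_congr rfl fun j hj => by
        obtain ⟨h1, h2⟩ := Finset.mem_sdiff.1 hj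
        simp [h2, Finset.mem_compl.1 h1]
  rw [a1, a2, a3]
  ring

/-- The components formed with the numbers `β` in terms of those formed with `α`. -/
lemma mixedSum_expand {ι : Type} [Fintype ι] (c : ι → ℂ) {D : ι → Fin d → I → ℂ}
    (hD : ∀ i j, Integrable (D i j) volume) (α β : ι → Fin d → ℂ) (ε : ℂ)
    (h : ∀ i j, β i j = α i j + ε * ∫ s : I, ((1 - (s : ℝ) : ℝ) : ℂ) * D i j s)
    (u : Finset (Fin d)) (x : Fin d → I) :
    mixedSum c D β u x = ∑ v ∈ uᶜ.powerset, ε ^ v.card *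
      ∫ t, (kernel v t : ℂ) * mixedSum c D α (u ∪ v) (u.piecewise x t) := by
  have e : ∀ v ∈ uᶜ.powerset,
      ∫ t, (kernel v t : ℂ) * mixedSum c D α (u ∪ v) (u.piecewise x t) =
      ∑ i, c i * ∫ t, (kernel v t : ℂ) *
        ∏ j, (if j ∈ u ∪ v then D i j (u.piecewise x t j) else α i j) := by
    intro v hv
    have huv : Disjoint u v := Finset.disjoint_left.2 fun j hj hj' =>
      Finset.mem_compl.1 (Finset.mem_powerset.1 hv hj') hj
    simp_rw [← integral_const_mul]
    rw [← integral_finsetSum]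
    · congr 1
      funext t
      rw [mixedSum, Finset.mul_sum]
      exact Finset.sum_congr rfl fun i _ => by ring
    · exact fun i _ => (integrable_kernel_mul_prod (hD i) (α i) huv x).const_mul _
  rw [Finset.sum_congr rfl fun v hv => by rw [e v hv], mixedSum]
  simp_rw [Finset.mul_sum]
  rw [Finset.sum_comm]
  refine Finset.sum_congr rfl fun i _ => ?_
  rw [prod_expand (D i) (α i) (β i) ε (h i) u x, Finset.mul_sum]
  exact Finset.sum_congr rfl fun v _ => by ring

lemma enorm_mixedSum_le {ι : Type} [Fintype ι] (c : ι → ℂ) {D : ι → Fin d → I → ℂ}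
    (hD : ∀ i j, Integrable (D i j) volume) (α β : ι → Fin d → ℂ) {ε : ℂ} (hε : ‖ε‖ = 1)
    (h : ∀ i j, β i j = α i j + ε * ∫ s : I, ((1 - (s : ℝ) : ℝ) : ℂ) * D i j s)
    (u : Finset (Fin d)) (x : Fin d → I) :
    ‖mixedSum c D β u x‖ₑ ≤ ∑ v ∈ uᶜ.powerset, ∫⁻ t, ENNReal.ofReal (kernel v t) *
      ‖mixedSum c D α (u ∪ v) (u.piecewise x t)‖ₑ := by
  have hε' : ‖ε‖ₑ = 1 := by rw [← ofReal_norm, hε, ENNReal.ofReal_one]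
  rw [mixedSum_expand c hD α β ε h u x]
  refine (enorm_sum_le _ _).trans (Finset.sum_le_sum fun v _ => ?_)
  rw [enorm_mul, enorm_pow, hε', one_pow, one_mul]
  refine (enorm_integral_le_lintegral_enorm _).trans_eq (lintegral_congr fun t => ?_)
  rw [enorm_mul, ← ofReal_norm, Complex.norm_real, Real.norm_of_nonneg (kernel_nonneg v t)]

end

/-! ### Schur test -/

/-- Hölder's inequality for a weighted sum of weighted integrals, with all the weights taken
together as one measure. -/
lemma sum_mul_lintegral_rpow_le {Ω κ : Type*} [MeasurableSpace Ω] {μ : Measure Ω} (s : Finset κ)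
    (r : κ → ℝ≥0∞) (k M : κ → Ω → ℝ≥0∞) (hk : ∀ v, Measurable (k v))
    (hM : ∀ v, Measurable (M v)) (hk0 : ∀ v, ∫⁻ t, k v t ∂μ ≠ 0)
    (hk1 : ∀ v, ∫⁻ t, k v t ∂μ ≠ ∞) {q : ℝ} (hq : 1 ≤ q) :
    (∑ v ∈ s, r v * ∫⁻ t, k v t * M v t ∂μ) ^ q ≤
      (∑ v ∈ s, r v * ∫⁻ t, k v t ∂μ) ^ (q - 1) *
        ∑ v ∈ s, r v * ∫⁻ t, k v t * M v t ^ q ∂μ := by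
  have hq0 : 0 < q := zero_lt_one.trans_le hq
  have hqi : 0 ≤ q⁻¹ := inv_nonneg.2 hq0.le
  have hqi' : 0 ≤ 1 - q⁻¹ := sub_nonneg.2 (inv_le_one_of_one_le₀ hq)
  -- Hölder for each single measure `k v ∂μ`, in averaged form so that the finite weighted Hölder
  -- inequality applies to the averages.
  have key : ∀ v, ∫⁻ t, k v t * M v t ∂μ ≤
      (∫⁻ t, k v t ∂μ) * ((∫⁻ t, k v t ∂μ)⁻¹ * ∫⁻ t, k v t * M v t ^ q ∂μ) ^ q⁻¹ := by
    intro v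
    have h := ENNReal.lintegral_mul_norm_pow_le (μ := μ) (hk v).aemeasurable
      (((hk v).mul ((hM v).pow_const q)).aemeasurable) hqi' hqi (by ring)
    have e1 : ∀ t, k v t ^ (1 - q⁻¹) * (k v t * M v t ^ q) ^ q⁻¹ = k v t * M v t := by
      intro t
      rw [ENNReal.mul_rpow_of_nonneg _ _ hqi, ← ENNReal.rpow_mul, mul_inv_cancel₀ hq0.ne',
        ENNReal.rpow_one, ← mul_assoc, ← ENNReal.rpow_add_of_nonneg _ _ hqi' hqi,
        sub_add_cancel, ENNReal.rpow_one]
    simp only [Pi.mul_apply, e1] at h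
    refine h.trans_eq ?_
    rw [ENNReal.mul_rpow_of_nonneg _ _ hqi, ← mul_assoc, ENNReal.inv_rpow,
      ENNReal.rpow_sub _ _ (hk0 v) (hk1 v), ENNReal.rpow_one, div_eq_mul_inv]
  have h2 : ∑ v ∈ s, r v * ∫⁻ t, k v t * M v t ∂μ ≤
      (∑ v ∈ s, r v * ∫⁻ t, k v t ∂μ) ^ (1 - q⁻¹) *
        (∑ v ∈ s, r v * ∫⁻ t, k v t * M v t ^ q ∂μ) ^ q⁻¹ := by
    refine (Finset.sum_le_sum fun v _ => mul_le_mul_right (key v) (r v)).trans ?_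
    simp_rw [← mul_assoc]
    refine (ENNReal.inner_le_weight_mul_Lp_of_nonneg s hq (fun v => r v * ∫⁻ t, k v t ∂μ)
      fun v => ((∫⁻ t, k v t ∂μ)⁻¹ * ∫⁻ t, k v t * M v t ^ q ∂μ) ^ q⁻¹).trans_eq ?_
    congr 2
    refine Finset.sum_congr rfl fun v _ => ?_
    rw [← ENNReal.rpow_mul, inv_mul_cancel₀ hq0.ne', ENNReal.rpow_one, mul_assoc, ← mul_assoc
      (∫⁻ t, k v t ∂μ), ENNReal.mul_inv_cancel (hk0 v) (hk1 v), one_mul]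
  refine (ENNReal.rpow_le_rpow h2 hq0.le).trans_eq ?_
  rw [ENNReal.mul_rpow_of_nonneg _ _ hq0.le, ← ENNReal.rpow_mul, ← ENNReal.rpow_mul,
    inv_mul_cancel₀ hq0.ne', ENNReal.rpow_one, sub_mul, one_mul, inv_mul_cancel₀ hq0.ne']

/-- Summation over disjoint pairs `(u, v)` as summation over pairs `u ⊆ w`, with `w = u ∪ v`. -/
lemma sum_powerset_compl_union {d : ℕ} (F : Finset (Fin d) → Finset (Fin d) → ℝ≥0∞) :
    ∑ u, ∑ v ∈ uᶜ.powerset, F u (u ∪ v) = ∑ w, ∑ u ∈ w.powerset, F u w := by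
  have h : ∀ u : Finset (Fin d), ∑ v ∈ uᶜ.powerset, F u (u ∪ v) =
      ∑ w ∈ Finset.univ.filter (u ⊆ ·), F u w := by
    intro u
    refine Finset.sum_nbij' (fun v => u ∪ v) (fun w => w \ u) ?_ ?_ ?_ ?_ ?_
    · intro v _; simp
    · intro w _
      rw [Finset.mem_powerset]
      intro j hj
      simpa using (Finset.mem_sdiff.1 hj).2
    · intro v hv
      rw [Finset.union_sdiff_left, Finset.sdiff_eq_self_iff_disjoint]
      exact Finset.disjoint_left.2 fun j hj hj' =>
        Finset.mem_compl.1 (Finset.mem_powerset.1 hv hj) hj'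
    · intro w hw
      exact Finset.union_sdiff_of_subset (Finset.mem_filter.1 hw).2
    · intro v _; rfl
  simp_rw [h]
  exact Finset.sum_comm' (by simp)

section

variable {d : ℕ}

lemma lintegral_lintegral_piecewise (u : Finset (Fin d)) {G : (Fin d → I) → ℝ≥0∞}
    (hG : Measurable G) : ∫⁻ x, ∫⁻ t, G (u.piecewise x t) = ∫⁻ z, G z := by
  have h := measurePreserving_piecewise u
  rw [← h.lintegral_comp hG]
  exact (lintegral_prod _ (hG.comp h.measurable).aemeasurable).symm

lemma ae_ae_piecewise (u : Finset (Fin d)) {P : (Fin d → I) → Prop} (hP : ∀ᵐ z, P z) :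
    ∀ᵐ x : Fin d → I, ∀ᵐ t : Fin d → I, P (u.piecewise x t) :=
  Measure.ae_ae_of_ae_prod ((measurePreserving_piecewise u).quasiMeasurePreserving.ae hP)

lemma measurable_piecewise_right (u : Finset (Fin d)) (x : Fin d → I) :
    Measurable fun t : Fin d → I => u.piecewise x t := by
  refine measurable_pi_lambda _ fun j => ?_
  by_cases hj : j ∈ u <;> simp only [Finset.piecewise, hj, if_true, if_false] <;> fun_prop

lemma measurable_kernel (v : Finset (Fin d)) :
    Measurable fun t : Fin d → I => ENNReal.ofReal (kernel v t) :=
  (continuous_kernel v).measurable.ennreal_ofReal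

/-- The Schur test for the family of kernels `r u (u ∪ v) * kernel v`: `C₂` bounds the row sums,
and `C₁` the column sums, where `kernel v ≤ 1` is used. -/
lemma sum_lintegral_rpow_le {r : Finset (Fin d) → Finset (Fin d) → ℝ≥0∞} {C₁ C₂ : ℝ≥0∞}
    (hC₁ : ∀ w, ∑ u ∈ w.powerset, r u w ≤ C₁)
    (hC₂ : ∀ u, ∑ v ∈ uᶜ.powerset, r u (u ∪ v) * 2⁻¹ ^ v.card ≤ C₂)
    {L M : Finset (Fin d) → (Fin d → I) → ℝ≥0∞} (hM : ∀ w, Measurable (M w))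
    (hL : ∀ u, ∀ᵐ x, L u x ≤ ∑ v ∈ uᶜ.powerset, r u (u ∪ v) *
      ∫⁻ t, ENNReal.ofReal (kernel v t) * M (u ∪ v) (u.piecewise x t))
    {q : ℝ} (hq : 1 ≤ q) :
    ∑ u, ∫⁻ x, L u x ^ q ≤ C₂ ^ (q - 1) * C₁ * ∑ w, ∫⁻ x, M w x ^ q := by
  have hq0 : 0 < q := zero_lt_one.trans_le hq
  have hsec : ∀ (u w : Finset (Fin d)), Measurable fun x : Fin d → I =>
      ∫⁻ t, M w (u.piecewise x t) ^ q := fun u w =>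
    (((hM w).pow_const q).comp (measurePreserving_piecewise u).measurable).lintegral_prod_right'
  have h1 : ∀ u, ∫⁻ x, L u x ^ q ≤
      ∑ v ∈ uᶜ.powerset, C₂ ^ (q - 1) * (r u (u ∪ v) * ∫⁻ z, M (u ∪ v) z ^ q) := by
    intro u
    have h2 : ∀ᵐ x, L u x ^ q ≤ ∑ v ∈ uᶜ.powerset, C₂ ^ (q - 1) * (r u (u ∪ v) *
        ∫⁻ t, M (u ∪ v) (u.piecewise x t) ^ q) := by
      filter_upwards [hL u] with x hx
      have hH := sum_mul_lintegral_rpow_le (μ := (volume : Measure (Fin d → I))) uᶜ.powerset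
        (fun v => r u (u ∪ v)) (fun v t => ENNReal.ofReal (kernel v t))
        (fun v t => M (u ∪ v) (u.piecewise x t)) measurable_kernel
        (fun v => (hM _).comp (measurable_piecewise_right u x))
        (fun v => by rw [lintegral_kernel]; simp) (fun v => by rw [lintegral_kernel]; simp) hq
      simp_rw [lintegral_kernel] at hH
      refine ((ENNReal.rpow_le_rpow hx hq0.le).trans hH).trans ?_
      rw [← Finset.mul_sum]
      refine mul_le_mul' (ENNReal.rpow_le_rpow (hC₂ u) (by linarith))
        (Finset.sum_le_sum fun v _ => mul_le_mul_right (lintegral_mono fun t => ?_) _)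
      exact mul_le_of_le_one_left' (by simpa using kernel_le_one v t)
    refine (lintegral_mono_ae h2).trans_eq ?_
    rw [lintegral_finsetSum _ fun v _ => ((hsec u _).const_mul _).const_mul _]
    refine Finset.sum_congr rfl fun v _ => ?_
    rw [lintegral_const_mul _ ((hsec u _).const_mul _), lintegral_const_mul _ (hsec u _),
      lintegral_lintegral_piecewise u ((hM _).pow_const q)]
  refine (Finset.sum_le_sum fun u _ => h1 u).trans ?_
  rw [sum_powerset_compl_union fun u w => C₂ ^ (q - 1) * (r u w * ∫⁻ z, M w z ^ q),
    Finset.mul_sum]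
  refine Finset.sum_le_sum fun w _ => ?_
  rw [← Finset.mul_sum, ← Finset.sum_mul, mul_assoc]
  exact mul_le_mul_right (mul_le_mul_left (hC₁ w) _) _

/-- The estimate of the supremum, which needs the row sums only. -/
lemma ae_le_of_ae_le_const {r : Finset (Fin d) → Finset (Fin d) → ℝ≥0∞} {C₂ : ℝ≥0∞}
    (hC₂ : ∀ u, ∑ v ∈ uᶜ.powerset, r u (u ∪ v) * 2⁻¹ ^ v.card ≤ C₂)
    {L M : Finset (Fin d) → (Fin d → I) → ℝ≥0∞}
    (hL : ∀ u, ∀ᵐ x, L u x ≤ ∑ v ∈ uᶜ.powerset, r u (u ∪ v) *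
      ∫⁻ t, ENNReal.ofReal (kernel v t) * M (u ∪ v) (u.piecewise x t))
    {S : ℝ≥0∞} (hS : ∀ w, ∀ᵐ z, M w z ≤ S) (u : Finset (Fin d)) :
    ∀ᵐ x, L u x ≤ C₂ * S := by
  filter_upwards [hL u, ae_ae_piecewise u (ae_all_iff.2 hS)] with x hx hx'
  refine le_trans ?_ (mul_le_mul_left (hC₂ u) S)
  rw [Finset.sum_mul]
  refine hx.trans (Finset.sum_le_sum fun v _ => ?_)
  rw [mul_assoc, ← lintegral_kernel, ← lintegral_mul_const _ (measurable_kernel v)]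
  refine mul_le_mul_right (lintegral_mono_ae ?_) _
  filter_upwards [hx'] with t ht using mul_le_mul_right (ht _) _

end

/-! ### The anchored and ANOVA components dominate each other -/

section

variable {d : ℕ}

lemma mixedSum_eq_comp {ι : Type} [Fintype ι] (c : ι → ℂ) (D : ι → Fin d → I → ℂ)
    (α : ι → Fin d → ℂ) (u : Finset (Fin d)) :
    mixedSum c D α u = (fun x : u → I => ∑ i, c i *
      ((∏ j : {j // j ∉ u}, α i j) * ∏ j : u, D i j (x j))) ∘ fun z (j : u) => z j := by
  funext z
  refine Finset.sum_congr rfl fun i _ => ?_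
  rw [← Fintype.prod_subtype_mul_prod_subtype (fun j => j ∈ u)]
  refine congrArg (c i * ·) ((mul_comm _ _).trans (congrArg₂ (· * ·) ?_ ?_))
  · exact Finset.prod_congr rfl fun j _ => if_neg j.2
  · exact Finset.prod_congr (by ext; simp) fun j _ => if_pos j.2

lemma aestronglyMeasurable_mixedSum {p : ℝ≥0∞} {ι : Type} [Fintype ι] (c : ι → ℂ)
    {g : ι → Fin d → I → ℂ} (hg : ∀ i j, g i j ∈ univariate p) (α : ι → Fin d → ℂ)
    (u : Finset (Fin d)) :
    AEStronglyMeasurable (mixedSum c (fun i j => unitDeriv (g i j)) α u) volume := by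
  rw [mixedSum_eq_comp]
  exact (memLp_sum_prod c hg u _).1.comp_measurePreserving (measurePreserving_restrict u)

lemma eLpNorm_eq_mixedSum {p : ℝ≥0∞} {ι : Type} [Fintype ι] (c : ι → ℂ)
    {g : ι → Fin d → I → ℂ} (hg : ∀ i j, g i j ∈ univariate p) (α : ι → Fin d → ℂ)
    (u : Finset (Fin d)) {T : (u → I) → ℂ}
    (hT : T =ᵐ[volume] fun x => ∑ i, c i *
      ((∏ j : {j // j ∉ u}, α i j) * ∏ j : u, unitDeriv (g i j) (x j))) :
    eLpNorm T p volume = eLpNorm (mixedSum c (fun i j => unitDeriv (g i j)) α u) p volume := by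
  rw [eLpNorm_congr_ae hT, mixedSum_eq_comp,
    eLpNorm_comp_measurePreserving (memLp_sum_prod c hg u _).1 (measurePreserving_restrict u)]

/-- The components `R' f u` are dominated by those of `R f`, after extension to the cube: they are
represented by functions `B u` and `A w`, with the same `L_p` norms, such that
`|B u x| ≤ ∑_{v ⊆ uᶜ} ∫ ∏_{j ∈ v} (1 - t_j) |A (u ∪ v) (x_u ; t)| dt`. -/
def Dominates {p : ℝ≥0∞}
    (R R' : tensorSpace d p →ₗ[ℂ] ∀ u : Finset (Fin d), Lp ℂ p (volume : Measure (u → I))) :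
    Prop :=
  ∀ f, ∃ A B : Finset (Fin d) → (Fin d → I) → ℂ,
    (∀ w, AEStronglyMeasurable (A w) volume) ∧ (∀ w, ‖R f w‖ₑ = eLpNorm (A w) p volume) ∧
    (∀ u, ‖R' f u‖ₑ = eLpNorm (B u) p volume) ∧
    ∀ u x, ‖B u x‖ₑ ≤ ∑ v ∈ uᶜ.powerset,
      ∫⁻ t, ENNReal.ofReal (kernel v t) * ‖A (u ∪ v) (u.piecewise x t)‖ₑ

lemma enorm_anchoredTuple {p : ℝ≥0∞} {ι : Type} [Fintype ι] (c : ι → ℂ)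
    {g : ι → Fin d → I → ℂ} (hg : ∀ i j, g i j ∈ univariate p)
    (hf : tensorSum c g ∈ tensorSpace d p) (u : Finset (Fin d)) :
    ‖anchoredTuple d p ⟨_, hf⟩ u‖ₑ =
      eLpNorm (mixedSum c (fun i j => unitDeriv (g i j)) (fun i j => g i j 0) u) p volume :=
  (Lp.enorm_toLp (anchoredPart_memLp hf u)).trans
    (eLpNorm_eq_mixedSum c hg _ u (anchoredPart_tensorSum c hg u))

lemma enorm_anovaTuple {p : ℝ≥0∞} {ι : Type} [Fintype ι] (c : ι → ℂ)
    {g : ι → Fin d → I → ℂ} (hg : ∀ i j, g i j ∈ univariate p)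
    (hf : tensorSum c g ∈ tensorSpace d p) (u : Finset (Fin d)) :
    ‖anovaTuple d p ⟨_, hf⟩ u‖ₑ =
      eLpNorm (mixedSum c (fun i j => unitDeriv (g i j)) (fun i j => ∫ s, g i j s) u) p volume :=
  (Lp.enorm_toLp (anovaPart_memLp hf u)).trans
    (eLpNorm_eq_mixedSum c hg _ u (anovaPart_tensorSum c hg u))

lemma anchored_dominates_anova {p : ℝ≥0∞} (hp : 1 ≤ p) :
    Dominates (anchoredTuple d p) (anovaTuple d p) := by
  rintro ⟨f, hf⟩
  obtain ⟨n, c, g, hg, rfl⟩ := exists_tensorSum hf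
  refine ⟨_, _, aestronglyMeasurable_mixedSum c hg _, enorm_anchoredTuple c hg hf,
    enorm_anovaTuple c hg hf, enorm_mixedSum_le c
      (fun i j => unitDeriv_integrable hp (hg i j)) _ _ (ε := 1) (by simp) fun i j => ?_⟩
  rw [one_mul]
  exact integral_univariate hp (hg i j)

lemma anova_dominates_anchored {p : ℝ≥0∞} (hp : 1 ≤ p) :
    Dominates (anovaTuple d p) (anchoredTuple d p) := by
  rintro ⟨f, hf⟩
  obtain ⟨n, c, g, hg, rfl⟩ := exists_tensorSum hf
  refine ⟨_, _, aestronglyMeasurable_mixedSum c hg _, enorm_anovaTuple c hg hf,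
    enorm_anchoredTuple c hg hf, enorm_mixedSum_le c
      (fun i j => unitDeriv_integrable hp (hg i j)) _ _ (ε := -1) (by simp) fun i j => ?_⟩
  rw [integral_univariate hp (hg i j)]
  ring

/-! ### The constants as row and column sums -/

lemma sum_ratio_le_constOne (γ : Finset (Fin d) → ℝ≥0) (w : Finset (Fin d)) :
    ∑ u ∈ w.powerset, ((γ w / γ u : ℝ≥0) : ℝ≥0∞) ≤ ENNReal.ofReal (constOne γ) := by
  have h := Finset.le_sup' (fun u : Finset (Fin d) => ∑ v ∈ u.powerset, (γ u : ℝ) / γ v)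
    (Finset.mem_univ w)
  refine le_trans (le_of_eq ?_) (ENNReal.ofReal_le_ofReal h)
  rw [ENNReal.ofReal_sum_of_nonneg fun _ _ => by positivity]
  refine Finset.sum_congr rfl fun v _ => ?_
  rw [← NNReal.coe_div, ENNReal.ofReal_coe_nnreal]

lemma sum_ratio_le_constInfty (γ : Finset (Fin d) → ℝ≥0) (u : Finset (Fin d)) :
    ∑ v ∈ uᶜ.powerset, ((γ (u ∪ v) / γ u : ℝ≥0) : ℝ≥0∞) * 2⁻¹ ^ v.card ≤
      ENNReal.ofReal (constInfty γ) := by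
  have h := Finset.le_sup' (fun u : Finset (Fin d) =>
    ∑ v ∈ uᶜ.powerset, (2 : ℝ)⁻¹ ^ v.card * ((γ (u ∪ v) : ℝ) / γ u)) (Finset.mem_univ u)
  refine le_trans (le_of_eq ?_) (ENNReal.ofReal_le_ofReal h)
  rw [ENNReal.ofReal_sum_of_nonneg fun _ _ => by positivity]
  refine Finset.sum_congr rfl fun v _ => ?_
  rw [← NNReal.coe_div, ENNReal.ofReal_mul (by positivity), ENNReal.ofReal_coe_nnreal, mul_comm,
    ENNReal.ofReal_pow (by norm_num), ENNReal.ofReal_inv_of_pos (by norm_num)]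
  norm_num

lemma constOne_nonneg (γ : Finset (Fin d) → ℝ≥0) : 0 ≤ constOne γ :=
  le_trans (Finset.sum_nonneg fun _ _ => by positivity)
    (Finset.le_sup' (fun u : Finset (Fin d) => ∑ v ∈ u.powerset, (γ u : ℝ) / γ v)
      (Finset.mem_univ ∅))

lemma constInfty_nonneg (γ : Finset (Fin d) → ℝ≥0) : 0 ≤ constInfty γ :=
  le_trans (Finset.sum_nonneg fun _ _ => by positivity)
    (Finset.le_sup' (fun u : Finset (Fin d) =>
      ∑ v ∈ uᶜ.powerset, (2 : ℝ)⁻¹ ^ v.card * ((γ (u ∪ v) : ℝ) / γ u)) (Finset.mem_univ ∅))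

/-! ### The norm estimate and the extension to the completions -/

variable {p : ℝ≥0∞}
  {R R' : tensorSpace d p →ₗ[ℂ] ∀ u : Finset (Fin d), Lp ℂ p (volume : Measure (u → I))}
  {γ : Finset (Fin d) → ℝ≥0}

lemma enorm_Lp_eq_zero (hp0 : p ≠ 0) {u : Finset (Fin d)}
    {F : Lp ℂ p (volume : Measure (u → I))} : ‖F‖ₑ = 0 ↔ F = 0 := by
  rw [Lp.enorm_def, eLpNorm_eq_zero_iff (Lp.aestronglyMeasurable F) hp0, Lp.eq_zero_iff_ae_eq_zero]

lemma enorm_Lp_smul {u : Finset (Fin d)} (a : ℂ) (F : Lp ℂ p (volume : Measure (u → I))) :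
    ‖a • F‖ₑ = ‖a‖ₑ * ‖F‖ₑ := by
  rw [Lp.enorm_def, Lp.enorm_def, eLpNorm_congr_ae (Lp.coeFn_smul a F), eLpNorm_const_smul]

/-- Monotonicity of the support of `γ` makes functions admitted for one norm admitted for the
other. -/
lemma Dominates.mem_preSubmodule (h : Dominates R R') (hp : 1 ≤ p)
    (hγ : ∀ u v : Finset (Fin d), v ⊆ u → 0 < γ u → 0 < γ v)
    {f : tensorSpace d p} (hf : f ∈ preSubmodule R γ) : f ∈ preSubmodule R' γ := by
  intro u hu
  obtain ⟨A, B, hA, hRA, hRB, hB⟩ := h f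
  have hp0 : p ≠ 0 := (zero_lt_one.trans_le hp).ne'
  rw [← enorm_Lp_eq_zero hp0, hRB, eLpNorm_congr_ae (g := 0), eLpNorm_zero]
  have hA0 : ∀ᵐ z, ∀ v, A (u ∪ v) z = 0 := by
    refine ae_all_iff.2 fun v => ?_
    have h0 : γ (u ∪ v) = 0 := by
      by_contra hne
      exact (hγ _ u Finset.subset_union_left (pos_iff_ne_zero.2 hne)).ne' hu
    have := hf _ h0
    rw [← enorm_Lp_eq_zero hp0, hRA, eLpNorm_eq_zero_iff (hA _) hp0] at this
    exact this
  filter_upwards [ae_ae_piecewise u hA0] with x hx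
  rw [Pi.zero_apply, ← enorm_eq_zero, ← nonpos_iff_eq_zero]
  refine (hB u x).trans_eq (Finset.sum_eq_zero fun v _ => ?_)
  rw [lintegral_eq_zero_of_ae_eq_zero]
  filter_upwards [hx] with t ht
  simp [ht v]

/-- The bound for `B` after division by the weights, in terms of measurable versions of the `A w`.
In `ℝ≥0`, `0⁻¹ = 0`, so the left hand side vanishes for `γ u = 0`, and the summands with
`γ (u ∪ v) = 0` may vanish because then `A (u ∪ v) = 0` almost everywhere. -/
lemma weighted_pointwise_le {A B : Finset (Fin d) → (Fin d → I) → ℂ}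
    (hA : ∀ w, AEStronglyMeasurable (A w) volume) (hA0 : ∀ w, γ w = 0 → A w =ᵐ[volume] 0)
    (hB : ∀ u x, ‖B u x‖ₑ ≤ ∑ v ∈ uᶜ.powerset,
      ∫⁻ t, ENNReal.ofReal (kernel v t) * ‖A (u ∪ v) (u.piecewise x t)‖ₑ)
    (u : Finset (Fin d)) :
    ∀ᵐ x, (((γ u)⁻¹ : ℝ≥0) : ℝ≥0∞) * ‖B u x‖ₑ ≤ ∑ v ∈ uᶜ.powerset,
      ((γ (u ∪ v) / γ u : ℝ≥0) : ℝ≥0∞) * ∫⁻ t, ENNReal.ofReal (kernel v t) *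
        ((((γ (u ∪ v))⁻¹ : ℝ≥0) : ℝ≥0∞) * ‖(hA (u ∪ v)).mk _ (u.piecewise x t)‖ₑ) := by
  have h1 : ∀ᵐ z, ∀ w, ‖A w z‖ₑ = (γ w : ℝ≥0∞) *
      ((((γ w)⁻¹ : ℝ≥0) : ℝ≥0∞) * ‖(hA w).mk _ z‖ₑ) := by
    refine ae_all_iff.2 fun w => ?_
    by_cases hw : γ w = 0
    · filter_upwards [hA0 w hw] with z hz
      simp [hz, hw]
    · filter_upwards [(hA w).ae_eq_mk] with z hz
      rw [← mul_assoc, ← ENNReal.coe_mul, mul_inv_cancel₀ hw, ENNReal.coe_one, one_mul, ← hz]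
  filter_upwards [ae_ae_piecewise u h1] with x hx
  refine (mul_le_mul_right (hB u x) _).trans_eq ?_
  rw [Finset.mul_sum]
  refine Finset.sum_congr rfl fun v _ => ?_
  rw [div_eq_mul_inv, mul_comm (γ (u ∪ v)), ENNReal.coe_mul, mul_assoc,
    ← lintegral_const_mul' (γ (u ∪ v) : ℝ≥0∞) _ ENNReal.coe_ne_top]
  congr 1
  refine lintegral_congr_ae ?_
  filter_upwards [hx] with t ht
  rw [ht, mul_left_comm]

lemma enorm_weightedTuple_apply (f : PreSpace R γ) (u : Finset (Fin d)) :
    ‖weightedTuple R γ f u‖ₑ = (((γ u)⁻¹ : ℝ≥0) : ℝ≥0∞) * ‖R f.1 u‖ₑ := by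
  have : weightedTuple R γ f u = ((γ u : ℝ)⁻¹ : ℂ) • R f.1 u := rfl
  refine (congrArg enorm this).trans ((enorm_Lp_smul _ _).trans (congrArg (· * ‖R f.1 u‖ₑ) ?_))
  rw [← Complex.ofReal_inv, ← NNReal.coe_inv, ← ofReal_norm, Complex.norm_real,
    Real.norm_of_nonneg (NNReal.coe_nonneg _), ENNReal.ofReal_coe_nnreal]

lemma const_mul_eLpNorm_rpow (hp0 : p ≠ 0) (hp : p ≠ ∞) (a : ℝ≥0) (F : (Fin d → I) → ℂ) :
    ((a : ℝ≥0∞) * eLpNorm F p volume) ^ p.toReal = ∫⁻ x, ((a : ℝ≥0∞) * ‖F x‖ₑ) ^ p.toReal := by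
  have hq : 0 < p.toReal := ENNReal.toReal_pos hp0 hp
  simp_rw [ENNReal.mul_rpow_of_nonneg _ _ hq.le]
  rw [lintegral_const_mul' _ _ (by simp [hq.le]), eLpNorm_eq_lintegral_rpow_enorm_toReal hp0 hp,
    ← ENNReal.rpow_mul, one_div_mul_cancel hq.ne', ENNReal.rpow_one]

lemma enorm_eq_sum [Fact (1 ≤ p)] (hp0 : p ≠ 0) (hp : p ≠ ∞) (f : PreSpace R γ) :
    ‖f‖ₑ = (∑ u, ‖weightedTuple R γ f u‖ₑ ^ p.toReal) ^ (1 / p.toReal) := by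
  have hq : 0 < p.toReal := ENNReal.toReal_pos hp0 hp
  have h : ‖f‖ = ‖weightedTuple R γ f‖ := rfl
  rw [← ofReal_norm, h, PiLp.norm_eq_sum hq,
    ← ENNReal.ofReal_rpow_of_nonneg (by positivity) (by positivity),
    ENNReal.ofReal_sum_of_nonneg fun _ _ => by positivity]
  congr 1
  refine Finset.sum_congr rfl fun u _ => ?_
  rw [← ENNReal.ofReal_rpow_of_nonneg (norm_nonneg _) hq.le, ofReal_norm]

lemma enorm_weightedTuple_apply_le [Fact (1 ≤ p)] (f : PreSpace R γ) (u : Finset (Fin d)) :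
    ‖weightedTuple R γ f u‖ₑ ≤ ‖f‖ₑ := by
  rw [← ofReal_norm, ← ofReal_norm]
  exact ENNReal.ofReal_le_ofReal (PiLp.norm_apply_le (weightedTuple R γ f) u)

lemma enorm_le_of_forall [Fact (1 ≤ p)] (hp : p = ∞) (f : PreSpace R γ) {S : ℝ≥0∞}
    (hS : ∀ u, ‖weightedTuple R γ f u‖ₑ ≤ S) : ‖f‖ₑ ≤ S := by
  subst hp
  rcases eq_or_ne S ∞ with rfl | hS'
  · exact le_top
  have h : ‖f‖ = ⨆ u, ‖weightedTuple R γ f u‖ := PiLp.norm_eq_ciSup (weightedTuple R γ f)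
  rw [← ofReal_norm, h]
  refine ENNReal.ofReal_le_of_le_toReal (ciSup_le fun u => ?_)
  rw [← ENNReal.ofReal_le_iff_le_toReal hS', ofReal_norm]
  exact hS u

lemma Dominates.norm_le [Fact (1 ≤ p)] (h : Dominates R R') (f : PreSpace R γ)
    (f' : PreSpace R' γ) (hff' : f'.1 = f.1) :
    ‖f'‖ ≤ constOne γ ^ (1 / p).toReal * constInfty γ ^ (1 - (1 / p).toReal) * ‖f‖ := by
  have hp1 : 1 ≤ p := Fact.out
  have hp0 : p ≠ 0 := (zero_lt_one.trans_le hp1).ne'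
  obtain ⟨A, B, hA, hRA, hRB, hB⟩ := h f.1
  have hA0 : ∀ w, γ w = 0 → A w =ᵐ[volume] 0 := fun w hw => by
    rw [← eLpNorm_eq_zero_iff (hA w) hp0, ← hRA, enorm_Lp_eq_zero hp0]
    exact f.2 w hw
  have hL := weighted_pointwise_le hA hA0 hB
  have eA : ∀ w, ‖weightedTuple R γ f w‖ₑ =
      (((γ w)⁻¹ : ℝ≥0) : ℝ≥0∞) * eLpNorm ((hA w).mk _) p volume := fun w => by
    rw [enorm_weightedTuple_apply, hRA, eLpNorm_congr_ae (hA w).ae_eq_mk]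
  have eB : ∀ u, ‖weightedTuple R' γ f' u‖ₑ =
      (((γ u)⁻¹ : ℝ≥0) : ℝ≥0∞) * eLpNorm (B u) p volume := fun u => by
    rw [enorm_weightedTuple_apply, hff', hRB]
  have hC1 := constOne_nonneg γ
  have hC2 := constInfty_nonneg γ
  rcases eq_or_ne p ∞ with hp | hp
  · have hsup : ∀ F : (Fin d → I) → ℂ, eLpNorm F p volume = eLpNormEssSup F volume := by
      simp [hp]
    have hS : ∀ w, ∀ᵐ z, (((γ w)⁻¹ : ℝ≥0) : ℝ≥0∞) * ‖(hA w).mk _ z‖ₑ ≤ ‖f‖ₑ := by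
      intro w
      have h1 := enorm_weightedTuple_apply_le f w
      rw [eA, hsup] at h1
      filter_upwards [ae_le_eLpNormEssSup (f := (hA w).mk _) (μ := volume)] with z hz
      exact (mul_le_mul_right hz _).trans h1
    have hmain := ae_le_of_ae_le_const
      (r := fun u w => ((γ w / γ u : ℝ≥0) : ℝ≥0∞)) (sum_ratio_le_constInfty γ)
      (L := fun u x => (((γ u)⁻¹ : ℝ≥0) : ℝ≥0∞) * ‖B u x‖ₑ)
      (M := fun w z => (((γ w)⁻¹ : ℝ≥0) : ℝ≥0∞) * ‖(hA w).mk _ z‖ₑ) hL hS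
    have hu : ‖f'‖ₑ ≤ ENNReal.ofReal (constInfty γ) * ‖f‖ₑ := by
      refine enorm_le_of_forall hp f' fun u => ?_
      rw [eB, hsup, eLpNormEssSup, ← ENNReal.essSup_const_mul]
      exact essSup_le_of_ae_le _ (hmain u)
    rw [← ofReal_norm, ← ofReal_norm, ← ENNReal.ofReal_mul hC2,
      ENNReal.ofReal_le_ofReal_iff (by positivity)] at hu
    simpa [hp] using hu
  · have hq : 1 ≤ p.toReal := by simpa using ENNReal.toReal_mono hp hp1
    have hq0 : 0 < p.toReal := zero_lt_one.trans_le hq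
    have hmain := sum_lintegral_rpow_le
      (r := fun u w => ((γ w / γ u : ℝ≥0) : ℝ≥0∞)) (sum_ratio_le_constOne γ)
      (sum_ratio_le_constInfty γ)
      (L := fun u x => (((γ u)⁻¹ : ℝ≥0) : ℝ≥0∞) * ‖B u x‖ₑ)
      (M := fun w z => (((γ w)⁻¹ : ℝ≥0) : ℝ≥0∞) * ‖(hA w).mk _ z‖ₑ) 
      (fun w => ((hA w).stronglyMeasurable_mk.enorm).const_mul _) hL hq
    simp_rw [← const_mul_eLpNorm_rpow hp0 hp, ← eA, ← eB] at hmain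
    have h2 := ENNReal.rpow_le_rpow hmain (one_div_nonneg.2 hq0.le)
    rw [ENNReal.mul_rpow_of_nonneg _ _ (one_div_nonneg.2 hq0.le),
      ENNReal.mul_rpow_of_nonneg _ _ (one_div_nonneg.2 hq0.le), ← ENNReal.rpow_mul,
      ← enorm_eq_sum hp0 hp, ← enorm_eq_sum hp0 hp] at h2
    have e : (p.toReal - 1) * (1 / p.toReal) = 1 - 1 / p.toReal := by field_simp
    have e' : 0 ≤ 1 - 1 / p.toReal := by
      rw [← e]; exact mul_nonneg (by linarith) (by positivity)
    rw [e, ENNReal.ofReal_rpow_of_nonneg hC2 e',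
      ENNReal.ofReal_rpow_of_nonneg hC1 (by positivity), ← ofReal_norm, ← ofReal_norm,
      ← ENNReal.ofReal_mul (by positivity), ← ENNReal.ofReal_mul (by positivity),
      ENNReal.ofReal_le_ofReal_iff (by positivity)] at h2
    rw [ENNReal.toReal_div, ENNReal.toReal_one, mul_comm (constOne γ ^ _)]
    exact h2

lemma Dominates.exists_extension [Fact (1 ≤ p)] (h : Dominates R R')
    (hγ : ∀ u v : Finset (Fin d), v ⊆ u → 0 < γ u → 0 < γ v) :
    ∃ J : UniformSpace.Completion (PreSpace R γ) →L[ℂ] UniformSpace.Completion (PreSpace R' γ),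
      (∀ f : PreSpace R γ, ∃ f' : PreSpace R' γ, f'.toFun = f.toFun ∧
        J (f : UniformSpace.Completion (PreSpace R γ)) = f') ∧
      ‖J‖ ≤ constOne γ ^ (1 / p).toReal * constInfty γ ^ (1 - (1 / p).toReal) := by
  set C := constOne γ ^ (1 / p).toReal * constInfty γ ^ (1 - (1 / p).toReal) with hC
  have hC0 : 0 ≤ C := mul_nonneg (Real.rpow_nonneg (constOne_nonneg γ) _)
    (Real.rpow_nonneg (constInfty_nonneg γ) _)
  let J₀ : PreSpace R γ →ₗ[ℂ] PreSpace R' γ :=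
    Submodule.inclusion (p := preSubmodule R γ) (p' := preSubmodule R' γ)
      fun f hf => h.mem_preSubmodule Fact.out hγ hf
  let J₁ : PreSpace R γ →L[ℂ] PreSpace R' γ := J₀.mkContinuous C fun f => h.norm_le f (J₀ f) rfl
  let e : PreSpace R γ →L[ℂ] UniformSpace.Completion (PreSpace R γ) :=
    UniformSpace.Completion.toComplL
  let e' : PreSpace R' γ →L[ℂ] UniformSpace.Completion (PreSpace R' γ) :=
    UniformSpace.Completion.toComplL
  have hJ : ∀ f : PreSpace R γ, (e' ∘L J₁).extend e f = (J₀ f : PreSpace R' γ) := fun f =>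
    ContinuousLinearMap.extend_eq (e' ∘L J₁) (e := e) UniformSpace.Completion.denseRange_coe
      (UniformSpace.Completion.isUniformInducing_coe _) f
  refine ⟨(e' ∘L J₁).extend e, fun f => ⟨J₀ f, rfl, hJ f⟩,
    ContinuousLinearMap.opNorm_le_bound _ hC0 fun x => ?_⟩
  induction x using UniformSpace.Completion.induction_on with
  | hp => exact isClosed_le (by fun_prop) (by fun_prop)
  | ih f =>
    rw [hJ, UniformSpace.Completion.norm_coe, UniformSpace.Completion.norm_coe]
    exact h.norm_le f (J₀ f) rfl

end

end AnchoredAnova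

theorem theorem2 (d : ℕ) (p : ℝ≥0∞) [Fact (1 ≤ p)] (γ : Finset (Fin d) → ℝ≥0)
    (hγ : ∀ u v : Finset (Fin d), v ⊆ u → 0 < γ u → 0 < γ v) :
    (∃ J : AnchoredAnova.AnchoredSpace d p γ →L[ℂ] AnchoredAnova.AnovaSpace d p γ,
      (∀ f : AnchoredAnova.AnchoredPre d p γ, ∃ h : AnchoredAnova.AnovaPre d p γ,
        h.toFun = f.toFun ∧
          J (f : AnchoredAnova.AnchoredSpace d p γ) = (h : AnchoredAnova.AnovaSpace d p γ)) ∧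
      ‖J‖ ≤ AnchoredAnova.constOne γ ^ (1 / p).toReal *
        AnchoredAnova.constInfty γ ^ (1 - (1 / p).toReal)) ∧
    (∃ J : AnchoredAnova.AnovaSpace d p γ →L[ℂ] AnchoredAnova.AnchoredSpace d p γ,
      (∀ f : AnchoredAnova.AnovaPre d p γ, ∃ h : AnchoredAnova.AnchoredPre d p γ,
        h.toFun = f.toFun ∧
          J (f : AnchoredAnova.AnovaSpace d p γ) = (h : AnchoredAnova.AnchoredSpace d p γ)) ∧
      ‖J‖ ≤ AnchoredAnova.constOne γ ^ (1 / p).toReal *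
        AnchoredAnova.constInfty γ ^ (1 - (1 / p).toReal)) := by
  have hp : 1 ≤ p := Fact.out
  exact ⟨(AnchoredAnova.anchored_dominates_anova hp).exists_extension hγ,
    (AnchoredAnova.anova_dominates_anchored hp).exists_extension hγ⟩
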